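/- Let $d\ge 2$ and let $t\in\{5,7\}$. A finite nonempty set $X\subset S^{d-1}=\{x\in\mathbb{R}^d:\|x\|=1\}$ is a spherical $t$-design if $$\frac{1}{|X|}\sum_{x\in X}f(x)=\frac{1}{|S^{d-1}|}\int_{S^{d-1}}f\,d\sigma$$ for every real polynomial $f$ in $d$ variables of degree at most $t$, where $\sigma$ is the surface measure on $S^{d-1}$ and $|S^{d-1}|=\sigma(S^{d-1})$; for odd $t$, it is tight if $|X|=2\binom{d+(t-3)/2}{(t-1)/2}$. A family $\{R_i\}_{i\in I}$ of nonempty symmetric relations partitioning $X\times X$, with one of them, $R_0$, equal to the diagonal, is a symmetric association scheme if for all $i,j,k\in I$ the number $|\{z\in X:(x,z)\in R_i,\ (z,y)\in R_j\}|$ is the same for all $(x,y)\in R_k$. It is triply regular if, moreover, for all $i,j,k,l,m,n\in I$ the number $|\{w\in X:(w,x)\in R_m,\ (w,y)\in R_n,\ (w,z)\in R_l\}|$ is the same for all $x,y,z\in X$ with $(x,y)\in R_i$, $(y,z)\in R_j$, $(z,x)\in R_k$. Theorem. Let $X\subset S^{d-1}$ be a tight spherical $t$-design with $t\in\{5,7\}$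 and $d\ge2$, let $A'(X)=\{\langle x,y\rangle: x,y\in X,\ x\ne y\}$ and $s=|A'(X)|$. Then $X=-X$, $t=2s-1$, and the relations $$R_\alpha=\{(x,y)\in X\times X:\langle x,y\rangle=\alpha\},\qquad \alpha\in\{1\}\cup A'(X),$$ form a triply regular symmetric association scheme on $X$, with $R_1$ the diagonal. -/

import Mathlib

namespace SphericalDesign

open MeasureTheory

/-- Coherent configuration on a finite set `X`: the relations `R i` form a partition of `X × X`
(into nonempty classes), the transpose of a class is a class, a class meeting the diagonal lies in
the diagonal, and the intersection numbers are well defined. -/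
structure IsCoherentConfiguration {X I : Type*} [Finite X] (R : I → X → X → Prop) : Prop where
  nonempty : ∀ i, ∃ x y, R i x y
  existsUnique : ∀ x y, ∃! i, R i x y
  transpose : ∀ i, ∃ i', ∀ x y, R i' x y ↔ R i y x
  diagonal : ∀ i, (∃ x, R i x x) → ∀ x y, R i x y → x = y
  intersection : ∀ i j k, ∃ p : ℕ, ∀ x y, R k x y →
    Nat.card {z : X // R i x z ∧ R j z y} = p

/-- Symmetric association scheme, with `o` the index of the diagonal relation. -/
structure IsSymmetricAssociationScheme {X I : Type*} [Finite X] (R : I → X → X → Prop) (o : I) :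
    Prop extends IsCoherentConfiguration R where
  zero_iff : ∀ x y, R o x y ↔ x = y
  symmetric : ∀ i x y, R i x y ↔ R i y x

/-- Triply regular symmetric association scheme: the number of `w` in prescribed relations to
`x`, `y`, `z` depends only on these relations and on the relations between `x`, `y`, `z`. -/
structure IsTriplyRegularScheme {X I : Type*} [Finite X] (R : I → X → X → Prop) (o : I) :
    Prop extends IsSymmetricAssociationScheme R o where
  triple : ∀ i j k l m n, ∃ p : ℕ, ∀ x y z, R i x y → R j y z → R k z x →
    Nat.card {w : X // R m w x ∧ R n w y ∧ R l w z} = p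

/-- `X` is a spherical `t`-design in the unit sphere of `ℝᵈ`: a nonempty finite subset over which
the average of every polynomial of degree at most `t` is its average over the sphere with respect
to the surface measure. -/
structure IsDesign {d : ℕ} (t : ℕ) (X : Finset (EuclideanSpace ℝ (Fin d))) : Prop where
  pos : 0 < t
  nonempty : X.Nonempty
  subset_sphere : ∀ x ∈ X, x ∈ Metric.sphere (0 : EuclideanSpace ℝ (Fin d)) 1
  average_eq : ∀ f : MvPolynomial (Fin d) ℝ, f.totalDegree ≤ t →
    (1 / (X.card : ℝ)) * ∑ x ∈ X, MvPolynomial.eval (fun i => x i) f =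
      ⨍ x : Metric.sphere (0 : EuclideanSpace ℝ (Fin d)) 1,
        MvPolynomial.eval (fun i => (x : EuclideanSpace ℝ (Fin d)) i) f
          ∂((volume : Measure (EuclideanSpace ℝ (Fin d))).toSphere)

/-- The lower bound for the cardinality of a spherical `t`-design in the unit sphere of `ℝᵈ`
(for `d ≥ 2` and `t ≥ 1` no subtraction below is truncated). -/
def tightBound (d t : ℕ) : ℕ :=
  if Even t then (d + t / 2 - 1).choose (t / 2) + (d + t / 2 - 2).choose (t / 2 - 1)
  else 2 * (d + (t - 1) / 2 - 1).choose ((t - 1) / 2)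

/-- A tight `t`-design: a `t`-design whose cardinality attains the lower bound. -/
structure IsTightDesign {d : ℕ} (t : ℕ) (X : Finset (EuclideanSpace ℝ (Fin d))) : Prop
    extends IsDesign t X where
  card_eq : X.card = tightBound d t

/-- The angle set `A'(X)`: the inner products of distinct points of `X`; its cardinality is the
degree of `X`. -/
def angleSet {d : ℕ} (X : Finset (EuclideanSpace ℝ (Fin d))) : Set ℝ :=
  {a | ∃ x ∈ X, ∃ y ∈ X, x ≠ y ∧ inner ℝ x y = a}

/-- The relations `{(x, y) ∈ X × X | ⟪x, y⟫ = a}`, one for each `a ∈ {1} ∪ A'(X)`. -/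
def angleRel {d : ℕ} (X : Finset (EuclideanSpace ℝ (Fin d)))
    (a : ↥(insert (1 : ℝ) (angleSet X))) (x y : X) : Prop :=
  inner ℝ (x : EuclideanSpace ℝ (Fin d)) (y : EuclideanSpace ℝ (Fin d)) = (a : ℝ)

end SphericalDesign

/-!
The theorem rests on two consequences of one invariance. The surface measure of the sphere is
invariant under linear isometries, and any two families of vectors with equal Gram matrices are
related by one; so for a `t`-design `X` the sums
`∑ w ∈ X, p ⟪w, x⟫ * q ⟪w, y⟫ * r ⟪w, z⟫` with `deg p + deg q + deg r ≤ t` depend only on the inner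
products of `x`, `y`, `z` (`IsDesign.sum_eval_map`, `exists_linearIsometryEquiv_of_inner_eq`).

Taking powers of a single inner product, this yields the moments `∑ w ∈ X, ⟪w, x⟫ ^ k` for unit
vectors `x` and `k ≤ 7`. Put `t = 2 e + 1` and let `g` be the polynomial of degree `e` proportional
to the reproducing kernel of the homogeneous polynomials of degree `e` on the sphere:
`g u = u ^ 2 - 1 / (d + 2)` for `e = 2` and `g u = u * (u ^ 2 - 3 / (d + 4))` for `e = 3`. For a
tight design the moments show that the nonnegative terms `(1 + ⟪w, x⟫) * g ⟪w, x⟫ ^ 2` have as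
their sum the term of `w = x` alone. Hence the points of `X` other than `±x` have inner products
with `x` among the `e` roots of `g`. The corresponding sum with `1 - ⟪w, x⟫` is not zero, which
forces `-x ∈ X` (`IsDesign.eval_inner_eq_zero`, `IsDesign.neg_mem`), and further moments show that
every root of `g` occurs, so that the degree of `X` is `e + 1`.

For triple regularity, let `T = {±x, ±y, ±z} ⊆ X`. For `w ∈ X` outside `T` the three inner products
are roots of `g`, so the indicator of `⟪w, x⟫ = a`, `⟪w, y⟫ = b`, `⟪w, z⟫ = c` is a product of three
interpolation polynomials of degree at most `e - 1`. As `3 * (e - 1) ≤ t`, the sum of this product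
over all of `X` depends only on the inner products of `x`, `y`, `z`, and so does the
correction over `T`, since an isometry carries `T` to the corresponding set of the other triple
(`IsDesign.card_triple_eq`). The intersection numbers of the scheme are the triple numbers with
`y = z`.
-/

namespace SphericalDesign

open MeasureTheory Finset
open scoped Pointwise

/-! ### Linear isometries and the surface measure -/

/-- Families of vectors with equal Gram matrices satisfy the same linear relations, so mapping one
to the other defines an isometry on the span; it extends to the whole space. -/
theorem exists_linearIsometryEquiv_of_inner_eq {V ι : Type*} [NormedAddCommGroup V]
    [InnerProductSpace ℝ V] [FiniteDimensional ℝ V] [Fintype ι] (v v' : ι → V)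
    (h : ∀ i j, inner ℝ (v i) (v j) = inner ℝ (v' i) (v' j)) :
    ∃ U : V ≃ₗᵢ[ℝ] V, ∀ i, U (v i) = v' i := by
  classical
  set T := Fintype.linearCombination ℝ v with hT
  set T' := Fintype.linearCombination ℝ v' with hT'
  have hn : ∀ c, ‖T' c‖ = ‖T c‖ := by
    intro c
    have : ‖T' c‖ ^ 2 = ‖T c‖ ^ 2 := by
      rw [← real_inner_self_eq_norm_sq, ← real_inner_self_eq_norm_sq]
      simp only [hT, hT', Fintype.linearCombination_apply, sum_inner, inner_sum, inner_smul_left,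
        inner_smul_right, h]
    exact (sq_eq_sq₀ (norm_nonneg _) (norm_nonneg _)).1 this
  obtain ⟨g, hg⟩ := T.rangeRestrict.exists_rightInverse_of_surjective T.range_rangeRestrict
  have hg' : ∀ s, T (g s) = s := fun s ↦
    congrArg Subtype.val (LinearMap.congr_fun hg s)
  let L : LinearMap.range T →ₗᵢ[ℝ] V :=
    { toLinearMap := T' ∘ₗ g
      norm_map' := fun s ↦ by
        rw [LinearMap.comp_apply, hn, hg']; rfl }
  refine ⟨L.extend.toLinearIsometryEquiv rfl, fun i ↦ ?_⟩
  have hi : T (Pi.single i 1) = v i := by simp [hT]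
  have hi' : T' (Pi.single i 1) = v' i := by simp [hT']
  have hmem : v i ∈ LinearMap.range T := ⟨_, hi⟩
  have h1 : L.extend (v i) = L ⟨v i, hmem⟩ := L.extend_apply ⟨v i, hmem⟩
  have h2 : L ⟨v i, hmem⟩ = T' (g ⟨v i, hmem⟩) := rfl
  have h3 : T' (g ⟨v i, hmem⟩ - Pi.single i 1) = 0 := by
    rw [← norm_eq_zero, hn, map_sub, hg', hi, sub_self, norm_zero]
  rw [map_sub, hi', sub_eq_zero] at h3
  simp only [LinearIsometry.coe_toLinearIsometryEquiv]
  rw [h1, h2, h3]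

/-- The surface measure of a set is defined by the volume of the cone over it, which a linear
isometry preserves. -/
theorem measurePreserving_toSphere {E : Type*} [NormedAddCommGroup E] [InnerProductSpace ℝ E]
    [FiniteDimensional ℝ E] [MeasurableSpace E] [BorelSpace E] (U : E ≃ₗᵢ[ℝ] E) :
    MeasurePreserving
      (fun x : Metric.sphere (0 : E) 1 ↦ (⟨U x, by simp⟩ : Metric.sphere (0 : E) 1))
      (volume : Measure E).toSphere (volume : Measure E).toSphere := by
  have hm : Measurable
      (fun x : Metric.sphere (0 : E) 1 ↦ (⟨U x, by simp⟩ : Metric.sphere (0 : E) 1)) :=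
    (U.continuous.measurable.comp measurable_subtype_coe).subtype_mk
  refine ⟨hm, Measure.ext fun s hs ↦ ?_⟩
  rw [Measure.map_apply hm hs, Measure.toSphere_apply' _ hs, Measure.toSphere_apply' _ (hm hs)]
  congr 1
  have : (Set.Ioo (0 : ℝ) 1 • ((↑) '' ((fun x : Metric.sphere (0 : E) 1 ↦
      (⟨U x, by simp⟩ : Metric.sphere (0 : E) 1)) ⁻¹' s) : Set E)) =
      U ⁻¹' (Set.Ioo (0 : ℝ) 1 • ((↑) '' s : Set E)) := by
    ext y
    simp only [Set.mem_smul, Set.mem_image, Set.mem_preimage]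
    constructor
    · rintro ⟨r, hr, _, ⟨x, hx, rfl⟩, rfl⟩
      exact ⟨r, hr, _, ⟨_, hx, rfl⟩, by simp⟩
    · rintro ⟨r, hr, _, ⟨x, hx, rfl⟩, hy⟩
      refine ⟨r, hr, U.symm x, ⟨⟨U.symm x, by simp⟩, by simpa using hx, rfl⟩, ?_⟩
      apply U.injective
      simp [hy]
  rw [this]
  exact U.measurePreserving.measure_preimage_equiv (f := U.toMeasurableEquiv) _

/-! ### Sums over a design of polynomials in inner products -/

variable {d t : ℕ} {X : Finset (EuclideanSpace ℝ (Fin d))}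

theorem totalDegree_aeval_le {σ : Type*} (g : MvPolynomial σ ℝ) (hg : g.totalDegree ≤ 1)
    (p : Polynomial ℝ) : (Polynomial.aeval g p).totalDegree ≤ p.natDegree := by
  rw [Polynomial.aeval_eq_sum_range]
  refine MvPolynomial.totalDegree_finsetSum_le fun i hi ↦ ?_
  refine (MvPolynomial.totalDegree_smul_le _ _).trans ((MvPolynomial.totalDegree_pow _ _).trans ?_)
  have := Finset.mem_range.1 hi
  nlinarith

/-- The linear form `⟪·, x⟫` as a polynomial in the coordinates. -/
noncomputable def linForm (x : EuclideanSpace ℝ (Fin d)) : MvPolynomial (Fin d) ℝ :=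
  ∑ i, x i • MvPolynomial.X i

theorem totalDegree_linForm_le (x : EuclideanSpace ℝ (Fin d)) :
    (linForm x).totalDegree ≤ 1 :=
  MvPolynomial.totalDegree_finsetSum_le fun i _ ↦
    (MvPolynomial.totalDegree_smul_le _ _).trans (MvPolynomial.totalDegree_X i).le

theorem eval_aeval_linForm (x w : EuclideanSpace ℝ (Fin d)) (p : Polynomial ℝ) :
    MvPolynomial.eval (fun i ↦ w i) (Polynomial.aeval (linForm x) p) = p.eval (inner ℝ w x) := by
  have h : MvPolynomial.eval (fun i ↦ w i) (linForm x) = inner ℝ w x := by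
    simp [linForm, PiLp.inner_apply, MvPolynomial.smul_eval]
  rw [← h, Polynomial.aeval_def, Polynomial.hom_eval₂]
  have hc : (MvPolynomial.eval fun i ↦ w i).comp (algebraMap ℝ (MvPolynomial (Fin d) ℝ)) =
      RingHom.id ℝ := RingHom.ext fun c ↦ by simp [MvPolynomial.algebraMap_eq]
  rw [hc, Polynomial.eval₂_id]

/-- Sums over a design of polynomials in three inner products are invariant under a linear
isometry applied to the three vectors: the corresponding integral over the sphere is. -/
theorem IsDesign.sum_eval_map (hX : IsDesign t X)
    (U : EuclideanSpace ℝ (Fin d) ≃ₗᵢ[ℝ] EuclideanSpace ℝ (Fin d))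
    (x y z : EuclideanSpace ℝ (Fin d)) (p q r : Polynomial ℝ)
    (h : p.natDegree + q.natDegree + r.natDegree ≤ t) :
    ∑ w ∈ X, p.eval (inner ℝ w (U x)) * q.eval (inner ℝ w (U y)) * r.eval (inner ℝ w (U z)) =
      ∑ w ∈ X, p.eval (inner ℝ w x) * q.eval (inner ℝ w y) * r.eval (inner ℝ w z) := by
  have key : ∀ x y z : EuclideanSpace ℝ (Fin d),
      (1 / (X.card : ℝ)) *
        ∑ w ∈ X, p.eval (inner ℝ w x) * q.eval (inner ℝ w y) * r.eval (inner ℝ w z) =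
      ⨍ w : Metric.sphere (0 : EuclideanSpace ℝ (Fin d)) 1,
        p.eval (inner ℝ (w : EuclideanSpace ℝ (Fin d)) x) *
        q.eval (inner ℝ (w : EuclideanSpace ℝ (Fin d)) y) *
        r.eval (inner ℝ (w : EuclideanSpace ℝ (Fin d)) z)
          ∂((volume : Measure (EuclideanSpace ℝ (Fin d))).toSphere) := by
    intro x y z
    have := hX.average_eq (Polynomial.aeval (linForm x) p * Polynomial.aeval (linForm y) q *
      Polynomial.aeval (linForm z) r) ?_
    · simpa only [map_mul, eval_aeval_linForm] using this
    · have h1 := totalDegree_aeval_le _ (totalDegree_linForm_le x) p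
      have h2 := totalDegree_aeval_le _ (totalDegree_linForm_le y) q
      have h3 := totalDegree_aeval_le _ (totalDegree_linForm_le z) r
      have h4 := MvPolynomial.totalDegree_mul (Polynomial.aeval (linForm x) p *
        Polynomial.aeval (linForm y) q) (Polynomial.aeval (linForm z) r)
      have h5 := MvPolynomial.totalDegree_mul (Polynomial.aeval (linForm x) p)
        (Polynomial.aeval (linForm y) q)
      omega
  have hc : (1 / (X.card : ℝ)) ≠ 0 := by
    have := hX.nonempty.card_pos
    positivity
  refine mul_left_cancel₀ hc ?_
  rw [key, key, MeasureTheory.average_eq, MeasureTheory.average_eq]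
  congr 1
  conv_lhs => rw [← (measurePreserving_toSphere U).map_eq]
  rw [integral_map_of_stronglyMeasurable (measurePreserving_toSphere U).measurable]
  · simp only [LinearIsometryEquiv.inner_map_map]
  · refine Continuous.stronglyMeasurable ?_
    fun_prop

/-! ### Moments of a design -/

theorem IsDesign.norm_eq_one (hX : IsDesign t X) {x : EuclideanSpace ℝ (Fin d)} (hx : x ∈ X) :
    ‖x‖ = 1 := by
  simpa using hX.subset_sphere x hx

theorem IsDesign.sum_inner_pow_eq (hX : IsDesign t X) {x y : EuclideanSpace ℝ (Fin d)}
    (hxy : ‖x‖ = ‖y‖) {k : ℕ} (hk : k ≤ t) :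
    ∑ w ∈ X, inner ℝ w x ^ k = ∑ w ∈ X, inner ℝ w y ^ k := by
  obtain ⟨U, hU⟩ := exists_linearIsometryEquiv_of_inner_eq (fun _ : Unit ↦ y) (fun _ ↦ x)
    (fun _ _ ↦ by simp only [real_inner_self_eq_norm_sq, hxy])
  have := hX.sum_eval_map U y y y (.X ^ k) 1 1 (by simpa using hk)
  simpa [hU ()] using this

theorem IsDesign.sum_inner_pow_eq_mul (hX : IsDesign t X) {x e : EuclideanSpace ℝ (Fin d)}
    (he : ‖e‖ = 1) {k : ℕ} (hk : k ≤ t) :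
    ∑ w ∈ X, inner ℝ w x ^ k = ‖x‖ ^ k * ∑ w ∈ X, inner ℝ w e ^ k := by
  rw [hX.sum_inner_pow_eq (y := ‖x‖ • e) (by simp [norm_smul, he]) hk, mul_sum]
  simp [inner_smul_right, mul_pow]

theorem IsDesign.sum_inner_pow_of_odd (hX : IsDesign t X) (x : EuclideanSpace ℝ (Fin d))
    {k : ℕ} (hk : k ≤ t) (hodd : Odd k) : ∑ w ∈ X, inner ℝ w x ^ k = 0 := by
  have := hX.sum_inner_pow_eq (norm_neg x) hk
  simp only [inner_neg_right, hodd.neg_pow, sum_neg_distrib] at this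
  linarith

/-- Raising the degree of an even moment by two: if the mixed moments along two orthogonal
directions are `c` times the pure moment of the same degree, summing over an orthonormal basis
relates the moments of degrees `k` and `k + 2`. -/
theorem IsDesign.sum_inner_pow_succ_succ (hX : IsDesign t X) (hd : 0 < d) {k : ℕ} (hk : k + 2 ≤ t)
    {c : ℝ} (hc : ∀ a b : EuclideanSpace ℝ (Fin d), ‖a‖ = 1 → ‖b‖ = 1 → inner ℝ a b = 0 →
      ∑ w ∈ X, inner ℝ w a ^ k * inner ℝ w b ^ 2 = c * ∑ w ∈ X, inner ℝ w a ^ (k + 2))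
    {x : EuclideanSpace ℝ (Fin d)} (hx : ‖x‖ = 1) :
    ∑ w ∈ X, inner ℝ w x ^ k = (1 + (d - 1) * c) * ∑ w ∈ X, inner ℝ w x ^ (k + 2) := by
  let b := EuclideanSpace.basisFun (Fin d) ℝ
  let o : Fin d := ⟨0, hd⟩
  have ho : ‖b o‖ = 1 := b.orthonormal.1 o
  rw [hX.sum_inner_pow_eq (hx.trans ho.symm) (k := k) (by omega),
    hX.sum_inner_pow_eq (hx.trans ho.symm) hk]
  have h1 : ∑ w ∈ X, inner ℝ w (b o) ^ k =
      ∑ i, ∑ w ∈ X, inner ℝ w (b o) ^ k * inner ℝ w (b i) ^ 2 := by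
    rw [sum_comm]
    refine sum_congr rfl fun w hw ↦ ?_
    have h2 := b.sum_sq_norm_inner_left w
    simp only [Real.norm_eq_abs, sq_abs, hX.norm_eq_one hw, one_pow] at h2
    rw [← mul_sum, h2, mul_one]
  rw [h1, ← add_sum_erase _ _ (mem_univ o)]
  have h3 : ∀ i ∈ univ.erase o, ∑ w ∈ X, inner ℝ w (b o) ^ k * inner ℝ w (b i) ^ 2 =
      c * ∑ w ∈ X, inner ℝ w (b o) ^ (k + 2) := fun i hi ↦
    hc _ _ ho (b.orthonormal.1 i) (b.orthonormal.2 (ne_of_mem_erase hi).symm)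
  rw [sum_congr rfl h3, sum_const, card_erase_of_mem (mem_univ o), card_univ, Fintype.card_fin]
  simp only [← pow_add, nsmul_eq_mul, Nat.cast_pred hd]
  ring

theorem norm_add_smul_pow {a b : EuclideanSpace ℝ (Fin d)} (ha : ‖a‖ = 1) (hb : ‖b‖ = 1)
    (hab : inner ℝ a b = 0) (s : ℝ) (m : ℕ) : ‖a + s • b‖ ^ (2 * m) = (1 + s ^ 2) ^ m := by
  rw [pow_mul, norm_add_sq_real, ha, norm_smul, hb, inner_smul_right, hab]
  simp

theorem IsDesign.sum_inner_sq (hX : IsDesign t X) (hd : 0 < d) (ht : 2 ≤ t)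
    {x : EuclideanSpace ℝ (Fin d)} (hx : ‖x‖ = 1) :
    ∑ w ∈ X, inner ℝ w x ^ 2 = X.card / d := by
  have h := hX.sum_inner_pow_succ_succ hd (k := 0) ht (c := 1)
    (fun a b ha hb _ ↦ by
      simpa using hX.sum_inner_pow_eq (hb.trans ha.symm) ht) hx
  have : (0 : ℝ) < d := by exact_mod_cast hd
  simp at h
  rw [h]; field_simp

theorem IsDesign.sum_inner_pow_four (hX : IsDesign t X) (hd : 0 < d) (ht : 4 ≤ t)
    {x : EuclideanSpace ℝ (Fin d)} (hx : ‖x‖ = 1) :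
    ∑ w ∈ X, inner ℝ w x ^ 4 = 3 * X.card / (d * (d + 2)) := by
  have h := hX.sum_inner_pow_succ_succ hd (k := 2) ht (c := 1 / 3)
    (fun a b ha hb hab ↦ by
      have h0 := hX.sum_inner_pow_eq (hb.trans ha.symm) ht
      have h1 := hX.sum_inner_pow_eq_mul (x := a + (1 : ℝ) • b) ha ht
      have h2 := hX.sum_inner_pow_eq_mul (x := a + (-1 : ℝ) • b) ha ht
      rw [norm_add_smul_pow ha hb hab _ 2] at h1 h2
      simp only [inner_add_right, inner_smul_right] at h1 h2
      have h3 : ∀ w : EuclideanSpace ℝ (Fin d), (inner ℝ w a + 1 * inner ℝ w b) ^ 4 +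
          (inner ℝ w a + -1 * inner ℝ w b) ^ 4 = 2 * inner ℝ w a ^ 4 +
          12 * (inner ℝ w a ^ 2 * inner ℝ w b ^ 2) + 2 * inner ℝ w b ^ 4 := fun w ↦ by ring
      have h4 := congrArg₂ (· + ·) h1 h2
      simp only [← sum_add_distrib, h3] at h4
      simp only [sum_add_distrib, ← mul_sum] at h4
      linarith) hx
  rw [hX.sum_inner_sq hd (by omega) hx] at h
  have : (0 : ℝ) < d := by exact_mod_cast hd
  norm_num at h
  field_simp at h ⊢
  linarith

theorem IsDesign.sum_inner_pow_six (hX : IsDesign t X) (hd : 0 < d) (ht : 6 ≤ t)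
    {x : EuclideanSpace ℝ (Fin d)} (hx : ‖x‖ = 1) :
    ∑ w ∈ X, inner ℝ w x ^ 6 = 15 * X.card / (d * (d + 2) * (d + 4)) := by
  have h := hX.sum_inner_pow_succ_succ hd (k := 4) ht (c := 1 / 5)
    (fun a b ha hb hab ↦ by
      have h0 := hX.sum_inner_pow_eq (hb.trans ha.symm) ht
      have hs : ∀ s : ℝ, 2 * ∑ w ∈ X, inner ℝ w a ^ 6 +
          30 * s ^ 2 * ∑ w ∈ X, inner ℝ w a ^ 4 * inner ℝ w b ^ 2 +
          30 * s ^ 4 * ∑ w ∈ X, inner ℝ w a ^ 2 * inner ℝ w b ^ 4 +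
          2 * s ^ 6 * ∑ w ∈ X, inner ℝ w b ^ 6 =
            2 * (1 + s ^ 2) ^ 3 * ∑ w ∈ X, inner ℝ w a ^ 6 := by
        intro s
        have h1 := hX.sum_inner_pow_eq_mul (x := a + s • b) ha ht
        have h2 := hX.sum_inner_pow_eq_mul (x := a + (-s) • b) ha ht
        rw [norm_add_smul_pow ha hb hab _ 3] at h1 h2
        simp only [inner_add_right, inner_smul_right] at h1 h2
        have h3 : ∀ w : EuclideanSpace ℝ (Fin d), (inner ℝ w a + s * inner ℝ w b) ^ 6 +
            (inner ℝ w a + -s * inner ℝ w b) ^ 6 = 2 * inner ℝ w a ^ 6 +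
            30 * s ^ 2 * (inner ℝ w a ^ 4 * inner ℝ w b ^ 2) +
            30 * s ^ 4 * (inner ℝ w a ^ 2 * inner ℝ w b ^ 4) +
            2 * s ^ 6 * inner ℝ w b ^ 6 := fun w ↦ by ring
        have h4 := congrArg₂ (· + ·) h1 h2
        simp only [← sum_add_distrib, h3] at h4
        simp only [sum_add_distrib, ← mul_sum] at h4
        rw [h4]; ring
      -- The values at `s = 1` and `s = 2` determine both mixed moments.
      have h1 := hs 1
      have h2 := hs 2
      rw [h0] at h1 h2
      norm_num at h1 h2
      linarith) hx
  rw [hX.sum_inner_pow_four hd (by omega) hx] at h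
  have : (0 : ℝ) < d := by exact_mod_cast hd
  norm_num at h
  field_simp at h ⊢
  linarith

/-! ### Triple regularity -/

theorem natDegree_interpolate_le (R : Finset ℝ) (f : ℝ → ℝ) :
    (Lagrange.interpolate R id f).natDegree ≤ #R - 1 := by
  have h := Lagrange.degree_interpolate_le (s := R) f Function.injective_id.injOn
  exact Polynomial.natDegree_le_of_degree_le h

/-- Here `R` contains the inner products other than `±1`. Away from `±x`, `±y`, `±z` the number
of solutions is a sum of a polynomial of degree at most `3 * (#R - 1)`, hence invariant under
isometries; the correction over these six points is visibly so. -/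
theorem IsDesign.card_triple_eq (hX : IsDesign t X) (hneg : ∀ x ∈ X, -x ∈ X) (R : Finset ℝ)
    (hR : ∀ x ∈ X, ∀ y ∈ X, x ≠ y → x ≠ -y → inner ℝ x y ∈ R) (ht : 3 * (#R - 1) ≤ t)
    {x y z x' y' z' : EuclideanSpace ℝ (Fin d)} (hx : x ∈ X) (hy : y ∈ X) (hz : z ∈ X)
    (hx' : x' ∈ X) (hy' : y' ∈ X) (hz' : z' ∈ X) (hxy : inner ℝ x y = inner ℝ x' y')
    (hyz : inner ℝ y z = inner ℝ y' z') (hzx : inner ℝ z x = inner ℝ z' x') (a b c : ℝ) :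
    #{w ∈ X | inner ℝ w x = a ∧ inner ℝ w y = b ∧ inner ℝ w z = c} =
      #{w ∈ X | inner ℝ w x' = a ∧ inner ℝ w y' = b ∧ inner ℝ w z' = c} := by
  classical
  obtain ⟨U, hU⟩ := exists_linearIsometryEquiv_of_inner_eq ![x, y, z] ![x', y', z'] (by
    intro i j
    fin_cases i <;> fin_cases j <;>
      simp [hX.norm_eq_one, hx, hy, hz, hx', hy', hz', hxy, hyz, hzx,
        real_inner_comm x y, real_inner_comm y z, real_inner_comm z x,
        real_inner_comm x' y', real_inner_comm y' z', real_inner_comm z' x'])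
  obtain rfl : U x = x' := hU 0
  obtain rfl : U y = y' := hU 1
  obtain rfl : U z = z' := hU 2
  -- Polynomials of degree less than `#R` that agree on `R` with the indicator functions.
  let φ : ℝ → Polynomial ℝ := fun a ↦ Lagrange.interpolate R id fun u ↦ if u = a then 1 else 0
  have hφd : ∀ a, (φ a).natDegree ≤ #R - 1 := fun a ↦ natDegree_interpolate_le _ _
  have hφ : ∀ a, ∀ u ∈ R, (φ a).eval u = if u = a then 1 else 0 := fun a u hu ↦
    Lagrange.eval_interpolate_at_node (v := id) _ Function.injective_id.injOn hu
  let T : Finset (EuclideanSpace ℝ (Fin d)) := {x, -x, y, -y, z, -z}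
  -- The difference between the indicator of the triple condition and its polynomial counterpart.
  let F : EuclideanSpace ℝ (Fin d) → EuclideanSpace ℝ (Fin d) → EuclideanSpace ℝ (Fin d) →
      EuclideanSpace ℝ (Fin d) → ℝ := fun x y z w ↦
    (if inner ℝ w x = a ∧ inner ℝ w y = b ∧ inner ℝ w z = c then 1 else 0)
      - (φ a).eval (inner ℝ w x) * (φ b).eval (inner ℝ w y) * (φ c).eval (inner ℝ w z)
  -- Away from `±x`, `±y`, `±z` the indicator is polynomial, so that `F` vanishes.
  have key : ∀ x y z, x ∈ X → y ∈ X → z ∈ X →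
      ((#{w ∈ X | inner ℝ w x = a ∧ inner ℝ w y = b ∧ inner ℝ w z = c} : ℕ) : ℝ) =
      ∑ w ∈ X, (φ a).eval (inner ℝ w x) * (φ b).eval (inner ℝ w y) * (φ c).eval (inner ℝ w z) +
      ∑ w ∈ ({x, -x, y, -y, z, -z} : Finset (EuclideanSpace ℝ (Fin d))), F x y z w := by
    intro x y z hx hy hz
    have hsub : ({x, -x, y, -y, z, -z} : Finset (EuclideanSpace ℝ (Fin d))) ⊆ X := by
      intro w hw
      simp only [mem_insert, mem_singleton] at hw
      rcases hw with rfl | rfl | rfl | rfl | rfl | rfl <;> first | assumption | exact hneg _ ‹_›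
    rw [sum_subset hsub, ← sum_add_distrib, card_filter]
    · push_cast
      exact sum_congr rfl fun w _ ↦ by simp only [F]; ring
    · intro w hw hwT
      simp only [mem_insert, mem_singleton, not_or] at hwT
      obtain ⟨h1, h2, h3, h4, h5, h6⟩ := hwT
      simp only [F, hφ _ _ (hR w hw x hx h1 h2), hφ _ _ (hR w hw y hy h3 h4),
        hφ _ _ (hR w hw z hz h5 h6), ite_and]
      split_ifs <;> simp
  have h1 := hX.sum_eval_map U x y z (φ a) (φ b) (φ c)
    (by have := hφd a; have := hφd b; have := hφd c; omega)
  have h2 : ({U x, -U x, U y, -U y, U z, -U z} : Finset (EuclideanSpace ℝ (Fin d))) =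
      T.image U := by
    simp [T, image_insert]
  have h3 := key x y z hx hy hz
  have h4 := key (U x) (U y) (U z) hx' hy' hz'
  rw [h1, h2, sum_image U.injective.injOn] at h4
  have h5 : ∀ w, F (U x) (U y) (U z) (U w) = F x y z w := fun w ↦ by
    simp only [F, LinearIsometryEquiv.inner_map_map]
  simp only [h5] at h4
  exact_mod_cast h3.trans h4.symm

theorem natCard_subtype_eq_card_filter {α : Type*} (X : Finset α) (P : α → Prop)
    [DecidablePred P] : Nat.card {w : X // P w} = #{w ∈ X | P w} := by
  rw [Nat.card_eq_fintype_card, Fintype.card_subtype, univ_eq_attach, ← card_map (.subtype _)]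
  congr 1
  ext w
  simp [and_comm]

/-- The condition on the strength bounds the degree of a product of three interpolation
polynomials on the set `R` of inner products other than `±1`. -/
theorem IsDesign.isTriplyRegularScheme (hX : IsDesign t X) (hneg : ∀ x ∈ X, -x ∈ X) (R : Finset ℝ)
    (hR : ∀ x ∈ X, ∀ y ∈ X, x ≠ y → x ≠ -y → inner ℝ x y ∈ R) (ht : 3 * (#R - 1) ≤ t) :
    IsTriplyRegularScheme (angleRel X) ⟨1, Set.mem_insert 1 (angleSet X)⟩ := by
  classical
  have hone : ∀ x y : X, inner ℝ (x : EuclideanSpace ℝ (Fin d)) y = (1 : ℝ) ↔ x = y := fun x y ↦ by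
    rw [inner_eq_one_iff_of_norm_eq_one (hX.norm_eq_one x.2) (hX.norm_eq_one y.2), Subtype.ext_iff]
  have hsymm : ∀ i (x y : X), angleRel X i x y ↔ angleRel X i y x := fun i x y ↦ by
    simp only [angleRel, real_inner_comm]
  have htriple : ∀ i j k l m n, ∃ p : ℕ, ∀ x y z, angleRel X i x y → angleRel X j y z →
      angleRel X k z x →
      Nat.card {w : X // angleRel X m w x ∧ angleRel X n w y ∧ angleRel X l w z} = p := by
    intro i j k l m n
    by_cases h : ∃ x y z, angleRel X i x y ∧ angleRel X j y z ∧ angleRel X k z x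
    · obtain ⟨x', y', z', h1, h2, h3⟩ := h
      refine ⟨Nat.card {w : X // angleRel X m w x' ∧ angleRel X n w y' ∧ angleRel X l w z'},
        fun x y z hi hj hk ↦ ?_⟩
      have := hX.card_triple_eq hneg R hR ht x.2 y.2 z.2 x'.2 y'.2 z'.2
        (Eq.trans hi (Eq.symm h1)) (Eq.trans hj (Eq.symm h2)) (Eq.trans hk (Eq.symm h3)) m n l
      have e := fun x y z : X ↦ natCard_subtype_eq_card_filter X
        (fun w ↦ inner ℝ w (x : EuclideanSpace ℝ (Fin d)) = (m : ℝ) ∧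
          inner ℝ w (y : EuclideanSpace ℝ (Fin d)) = (n : ℝ) ∧
          inner ℝ w (z : EuclideanSpace ℝ (Fin d)) = (l : ℝ))
      exact (e x y z).trans (this.trans (e x' y' z').symm)
    · exact ⟨0, fun x y z hi hj hk ↦ absurd ⟨x, y, z, hi, hj, hk⟩ h⟩
  refine
    { nonempty := ?_
      existsUnique := ?_
      transpose := fun i ↦ ⟨i, hsymm i⟩
      diagonal := ?_
      intersection := ?_
      zero_iff := hone
      symmetric := hsymm
      triple := htriple }
  · rintro ⟨a, rfl | ⟨x, hx, y, hy, _, h⟩⟩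
    · obtain ⟨x, hx⟩ := hX.nonempty
      exact ⟨⟨x, hx⟩, ⟨x, hx⟩, (hone _ _).2 rfl⟩
    · exact ⟨⟨x, hx⟩, ⟨y, hy⟩, h⟩
  · intro x y
    refine ⟨⟨inner ℝ (x : EuclideanSpace ℝ (Fin d)) y, ?_⟩, rfl,
      fun j hj ↦ Subtype.ext (Eq.symm hj)⟩
    by_cases h : x = y
    · exact Or.inl ((hone x y).2 h)
    · exact Or.inr ⟨x, x.2, y, y.2, fun h' ↦ h (Subtype.ext h'), rfl⟩
  · rintro i ⟨x, hx⟩ y z hyz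
    exact (hone y z).1 (Eq.trans hyz (Eq.trans (Eq.symm hx) ((hone x x).2 rfl)))
  · -- The intersection numbers are the triple numbers with `z = y`.
    intro i j k
    obtain ⟨p, hp⟩ := htriple k ⟨1, Set.mem_insert 1 (angleSet X)⟩ k j i j
    refine ⟨p, fun x y hxy ↦ ?_⟩
    rw [← hp x y y hxy ((hone y y).2 rfl) ((hsymm _ _ _).1 hxy)]
    simp only [and_self, hsymm i x]

/-! ### Tight designs -/

theorem IsDesign.abs_inner_le_one (hX : IsDesign t X) {x w : EuclideanSpace ℝ (Fin d)}
    (hx : x ∈ X) (hw : w ∈ X) : |inner ℝ w x| ≤ 1 := by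
  simpa [hX.norm_eq_one hx, hX.norm_eq_one hw] using abs_real_inner_le_norm w x

/-- The equality case of the linear programming bound: if the nonnegative terms
`(1 + u) * g u ^ 2`, with `u = ⟪w, x⟫`, have as their sum the term of `w = x`, then `g` vanishes at
the inner product of `x` with any point of the design other than `±x`. -/
theorem IsDesign.eval_inner_eq_zero (hX : IsDesign t X) {g : ℝ → ℝ}
    {x : EuclideanSpace ℝ (Fin d)} (hx : x ∈ X)
    (h : ∑ w ∈ X, (1 + inner ℝ w x) * g (inner ℝ w x) ^ 2 = 2 * g 1 ^ 2)
    {w : EuclideanSpace ℝ (Fin d)} (hw : w ∈ X) (h1 : w ≠ x) (h2 : w ≠ -x) :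
    g (inner ℝ w x) = 0 := by
  classical
  have hxx : inner ℝ x x = (1 : ℝ) := by
    rw [real_inner_self_eq_norm_sq, hX.norm_eq_one hx, one_pow]
  rw [← add_sum_erase _ _ hx, hxx] at h
  have h0 : ∑ w ∈ X.erase x, (1 + inner ℝ w x) * g (inner ℝ w x) ^ 2 = 0 := by linarith
  rw [sum_eq_zero_iff_of_nonneg] at h0
  · have := h0 w (mem_erase.2 ⟨h1, hw⟩)
    refine (pow_eq_zero_iff two_ne_zero).1 ((mul_eq_zero.1 this).resolve_left fun h3 ↦ h2 ?_)
    rw [← neg_inj, neg_neg, eq_comm,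
      ← inner_eq_one_iff_of_norm_eq_one (𝕜 := ℝ) (hX.norm_eq_one hx)
        (by rw [norm_neg, hX.norm_eq_one hw]), inner_neg_right, real_inner_comm]
    linarith
  · intro y hy
    have := abs_le.1 (hX.abs_inner_le_one hx (mem_of_mem_erase hy))
    exact mul_nonneg (by linarith) (sq_nonneg _)

/-- If `-x` were missing, all terms of the second sum would vanish. -/
theorem IsDesign.neg_mem (hX : IsDesign t X) {g : ℝ → ℝ} {x : EuclideanSpace ℝ (Fin d)}
    (hx : x ∈ X) (h : ∑ w ∈ X, (1 + inner ℝ w x) * g (inner ℝ w x) ^ 2 = 2 * g 1 ^ 2)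
    (h' : ∑ w ∈ X, (1 - inner ℝ w x) * g (inner ℝ w x) ^ 2 ≠ 0) : -x ∈ X := by
  by_contra hmem
  refine h' (sum_eq_zero fun w hw ↦ ?_)
  by_cases h1 : w = x
  · rw [h1, real_inner_self_eq_norm_sq, hX.norm_eq_one hx]; simp
  · rw [hX.eval_inner_eq_zero hx h hw h1 fun h2 ↦ hmem (h2 ▸ hw)]; simp

theorem IsDesign.ncard_angleSet (hX : IsDesign t X) (hneg : ∀ x ∈ X, -x ∈ X) (R : Finset ℝ)
    (hR : ∀ x ∈ X, ∀ y ∈ X, x ≠ y → x ≠ -y → inner ℝ x y ∈ R)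
    (hR1 : ∀ r ∈ R, -1 < r ∧ r < 1) (hRX : ∀ r ∈ R, ∃ x ∈ X, ∃ y ∈ X, inner ℝ x y = r) :
    (angleSet X).ncard = #R + 1 := by
  have hxx : ∀ x ∈ X, inner ℝ x x = (1 : ℝ) := fun x hx ↦ by
    rw [real_inner_self_eq_norm_sq, hX.norm_eq_one hx, one_pow]
  have hm : (-1 : ℝ) ∉ R := fun h ↦ (hR1 _ h).1.false
  have : angleSet X = ↑(insert (-1) R) := by
    ext a
    simp only [angleSet, Set.mem_ofPred_eq, coe_insert, Set.mem_insert_iff, mem_coe]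
    constructor
    · rintro ⟨x, hx, y, hy, hxy, rfl⟩
      by_cases h : x = -y
      · left; rw [h, inner_neg_left, hxx y hy]
      · exact Or.inr (hR x hx y hy hxy h)
    · rintro (rfl | ha)
      · obtain ⟨x, hx⟩ := hX.nonempty
        refine ⟨x, hx, -x, hneg x hx, fun h ↦ ?_, by rw [inner_neg_right, hxx x hx]⟩
        have h1 := hxx x hx
        nth_rw 2 [h] at h1
        rw [inner_neg_right, hxx x hx] at h1
        norm_num at h1
      · obtain ⟨x, hx, y, hy, h⟩ := hRX a ha
        refine ⟨x, hx, y, hy, fun hxy ↦ ?_, h⟩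
        rw [hxy, hxx y hy] at h
        exact ((hR1 a ha).2.ne h.symm).elim
  rw [this, Set.ncard_coe_finset, card_insert_of_notMem hm]

/-- The conclusions for a design whose inner products other than `±1` are controlled by a function
`g` with zeros in `R`. That every element of `R` occurs as an inner product may be shown using
antipodality and the vanishing of `g`. -/
theorem IsDesign.antipodal_and_triplyRegular (hX : IsDesign t X) {g : ℝ → ℝ} (R : Finset ℝ)
    (hg : ∀ u, g u = 0 → u ∈ R)
    (h : ∀ x ∈ X, ∑ w ∈ X, (1 + inner ℝ w x) * g (inner ℝ w x) ^ 2 = 2 * g 1 ^ 2)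
    (h' : ∀ x ∈ X, ∑ w ∈ X, (1 - inner ℝ w x) * g (inner ℝ w x) ^ 2 ≠ 0)
    (hR1 : ∀ r ∈ R, -1 < r ∧ r < 1) (ht : 3 * (#R - 1) ≤ t) (ht' : t = 2 * #R + 1)
    (hRX : (∀ x ∈ X, -x ∈ X) → (∀ x ∈ X, ∀ y ∈ X, x ≠ y → x ≠ -y → g (inner ℝ x y) = 0) →
      ∀ r ∈ R, ∃ x ∈ X, ∃ y ∈ X, inner ℝ x y = r) :
    (∀ x ∈ X, -x ∈ X) ∧ (t : ℤ) = 2 * ((angleSet X).ncard : ℤ) - 1 ∧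
      IsTriplyRegularScheme (angleRel X) ⟨1, Set.mem_insert 1 (angleSet X)⟩ := by
  have hneg : ∀ x ∈ X, -x ∈ X := fun x hx ↦ hX.neg_mem hx (h x hx) (h' x hx)
  have h0 : ∀ x ∈ X, ∀ y ∈ X, x ≠ y → x ≠ -y → g (inner ℝ x y) = 0 :=
    fun x hx y hy ↦ hX.eval_inner_eq_zero hy (h y hy) hx
  have hR := fun x hx y hy h1 h2 ↦ hg _ (h0 x hx y hy h1 h2)
  refine ⟨hneg, ?_, hX.isTriplyRegularScheme hneg R hR ht⟩
  rw [hX.ncard_angleSet hneg R hR hR1 (hRX hneg h0)]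
  omega

/-- The weight `1 - u ^ 2` discards the terms of `w = ±x`. -/
theorem IsDesign.exists_inner_ne_zero (hX : IsDesign t X) {x : EuclideanSpace ℝ (Fin d)}
    (hx : x ∈ X) (f : ℝ → ℝ) (h : ∑ w ∈ X, f (inner ℝ w x) * (1 - inner ℝ w x ^ 2) ≠ 0) :
    ∃ w ∈ X, w ≠ x ∧ w ≠ -x ∧ f (inner ℝ w x) ≠ 0 := by
  obtain ⟨w, hw, h1⟩ := exists_ne_zero_of_sum_ne_zero h
  refine ⟨w, hw, ?_, ?_, left_ne_zero_of_mul h1⟩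
  all_goals
    rintro rfl
    simp [hX.norm_eq_one hx] at h1

theorem IsTightDesign.of_five (hd : 2 ≤ d) (hX : IsTightDesign 5 X) :
    (∀ x ∈ X, -x ∈ X) ∧ ((5 : ℕ) : ℤ) = 2 * ((angleSet X).ncard : ℤ) - 1 ∧
      IsTriplyRegularScheme (angleRel X) ⟨1, Set.mem_insert 1 (angleSet X)⟩ := by
  have hD := hX.toIsDesign
  have hd' : (2 : ℝ) ≤ d := by exact_mod_cast hd
  have hd0 : 0 < d := by omega
  have hcard : (X.card : ℝ) = d * (d + 1) := by
    have h1 : X.card = 2 * (d + 1).choose 2 := by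
      rw [hX.card_eq, tightBound, if_neg (by decide)]; norm_num
    rw [h1]
    push_cast
    rw [Nat.cast_choose_two]
    push_cast
    ring
  have m1 := fun x ↦ hD.sum_inner_pow_of_odd x (k := 1) (by omega) (by decide)
  have m3 := fun x ↦ hD.sum_inner_pow_of_odd x (k := 3) (by omega) (by decide)
  have m5 := fun x ↦ hD.sum_inner_pow_of_odd x (k := 5) (by omega) (by decide)
  have m2 : ∀ x ∈ X, ∑ w ∈ X, inner ℝ w x ^ 2 = (d + 1 : ℝ) := fun x hx ↦ by
    rw [hD.sum_inner_sq hd0 (by omega) (hD.norm_eq_one hx), hcard]; field_simp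
  have m4 : ∀ x ∈ X, ∑ w ∈ X, inner ℝ w x ^ 4 = (3 * (d + 1) / (d + 2) : ℝ) := fun x hx ↦ by
    rw [hD.sum_inner_pow_four hd0 (by omega) (hD.norm_eq_one hx), hcard]; field_simp
  -- With this value `u ^ 2 - β` is, up to a scalar, the sum of the
  -- Gegenbauer polynomials of degrees `0` and `2`, normalized as reproducing kernels.
  set β : ℝ := 1 / (d + 2) with hβ
  have hβ0 : 0 < β := by positivity
  have hβ1 : β < 1 := by rw [hβ, div_lt_one (by positivity)]; linarith
  set r := √β
  have hr0 : 0 < r := Real.sqrt_pos.2 hβ0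
  have hrβ : r ^ 2 = β := Real.sq_sqrt hβ0.le
  have hr1 : r < 1 := by nlinarith
  -- The sum of `(1 + s * u) * g u ^ 2` does not depend on `s`.
  have hsum : ∀ s : ℝ, ∀ x ∈ X, ∑ w ∈ X, (1 + s * inner ℝ w x) * (inner ℝ w x ^ 2 - β) ^ 2 =
      2 * (1 ^ 2 - β) ^ 2 := by
    intro s x hx
    have he : ∀ u : ℝ, (1 + s * u) * (u ^ 2 - β) ^ 2 =
        s * u ^ 5 + u ^ 4 + (-2 * β * s) * u ^ 3 + (-2 * β) * u ^ 2 + s * β ^ 2 * u ^ 1 + β ^ 2 :=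
      fun u ↦ by ring
    simp only [he, sum_add_distrib, ← mul_sum, m1, m2 x hx, m3, m4 x hx, m5, sum_const,
      nsmul_eq_mul, hcard]
    rw [hβ]
    field_simp
    ring
  have hroot : ∀ u : ℝ, u ^ 2 - β = 0 → u = r ∨ u = -r := fun u hu ↦
    sq_eq_sq_iff_eq_or_eq_neg.1 (by linarith)
  have hcR : #({r, -r} : Finset ℝ) = 2 := card_pair (by linarith)
  refine hD.antipodal_and_triplyRegular (g := fun u ↦ u ^ 2 - β) {r, -r} (fun u hu ↦ ?_)
    (fun x hx ↦ ?_) (fun x hx ↦ ?_) ?_ (by rw [hcR]; norm_num) (by rw [hcR]) ?_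
  · simpa using hroot u hu
  · simpa using hsum 1 x hx
  · have := hsum (-1) x hx
    simp only [neg_one_mul, ← sub_eq_add_neg] at this
    rw [this]
    have : 1 - β ≠ 0 := by linarith
    simpa using this
  · simp only [mem_insert, mem_singleton]
    rintro _ (rfl | rfl) <;> constructor <;> linarith
  · intro hneg h0
    obtain ⟨x, hx⟩ := hD.nonempty
    obtain ⟨w, hw, h1, h2, -⟩ := hD.exists_inner_ne_zero hx (fun _ ↦ 1) (by
      simp only [one_mul, sum_sub_distrib, m2 x hx, sum_const, nsmul_eq_mul, hcard]
      nlinarith)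
    simp only [mem_insert, mem_singleton]
    rcases hroot _ (h0 w hw x hx h1 h2) with h3 | h3
    · rintro _ (rfl | rfl)
      · exact ⟨w, hw, x, hx, h3⟩
      · exact ⟨-w, hneg w hw, x, hx, by rw [inner_neg_left, h3]⟩
    · rintro _ (rfl | rfl)
      · exact ⟨-w, hneg w hw, x, hx, by rw [inner_neg_left, h3, neg_neg]⟩
      · exact ⟨w, hw, x, hx, h3⟩

theorem IsTightDesign.of_seven (hd : 2 ≤ d) (hX : IsTightDesign 7 X) :
    (∀ x ∈ X, -x ∈ X) ∧ ((7 : ℕ) : ℤ) = 2 * ((angleSet X).ncard : ℤ) - 1 ∧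
      IsTriplyRegularScheme (angleRel X) ⟨1, Set.mem_insert 1 (angleSet X)⟩ := by
  have hD := hX.toIsDesign
  have hd' : (2 : ℝ) ≤ d := by exact_mod_cast hd
  have hd0 : 0 < d := by omega
  have hcard : (X.card : ℝ) = d * (d + 1) * (d + 2) / 3 := by
    have h1 : X.card = 2 * (d + 2).choose 3 := by
      rw [hX.card_eq, tightBound, if_neg (by decide)]; norm_num
    have h2 := congrArg (Nat.cast (R := ℝ)) (Nat.add_one_mul_choose_eq (d + 1) 2)
    push_cast at h2
    rw [Nat.cast_choose_two] at h2
    rw [h1]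
    push_cast at h2 ⊢
    linarith
  have m1 := fun x ↦ hD.sum_inner_pow_of_odd x (k := 1) (by omega) (by decide)
  have m3 := fun x ↦ hD.sum_inner_pow_of_odd x (k := 3) (by omega) (by decide)
  have m5 := fun x ↦ hD.sum_inner_pow_of_odd x (k := 5) (by omega) (by decide)
  have m7 := fun x ↦ hD.sum_inner_pow_of_odd x (k := 7) (by omega) (by decide)
  have m2 : ∀ x ∈ X, ∑ w ∈ X, inner ℝ w x ^ 2 = ((d + 1) * (d + 2) / 3 : ℝ) := fun x hx ↦ by
    rw [hD.sum_inner_sq hd0 (by omega) (hD.norm_eq_one hx), hcard]; field_simp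
  have m4 : ∀ x ∈ X, ∑ w ∈ X, inner ℝ w x ^ 4 = (d + 1 : ℝ) := fun x hx ↦ by
    rw [hD.sum_inner_pow_four hd0 (by omega) (hD.norm_eq_one hx), hcard]; field_simp
  have m6 : ∀ x ∈ X, ∑ w ∈ X, inner ℝ w x ^ 6 = (5 * (d + 1) / (d + 4) : ℝ) := fun x hx ↦ by
    rw [hD.sum_inner_pow_six hd0 (by omega) (hD.norm_eq_one hx), hcard]; field_simp; norm_num
  -- With this value `u * (u ^ 2 - β)` is, up to a scalar, the sum of
  -- the Gegenbauer polynomials of degrees `1` and `3`, normalized as reproducing kernels.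
  set β : ℝ := 3 / (d + 4) with hβ
  have hβ0 : 0 < β := by positivity
  have hβ1 : β < 1 := by rw [hβ, div_lt_one (by positivity)]; linarith
  set r := √β
  have hr0 : 0 < r := Real.sqrt_pos.2 hβ0
  have hrβ : r ^ 2 = β := Real.sq_sqrt hβ0.le
  have hr1 : r < 1 := by nlinarith
  -- The sum of `(1 + s * u) * g u ^ 2` does not depend on `s`.
  have hsum : ∀ s : ℝ, ∀ x ∈ X,
      ∑ w ∈ X, (1 + s * inner ℝ w x) * (inner ℝ w x * (inner ℝ w x ^ 2 - β)) ^ 2 =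
        2 * (1 * (1 ^ 2 - β)) ^ 2 := by
    intro s x hx
    have he : ∀ u : ℝ, (1 + s * u) * (u * (u ^ 2 - β)) ^ 2 =
        s * u ^ 7 + u ^ 6 + (-2 * β * s) * u ^ 5 + (-2 * β) * u ^ 4 + s * β ^ 2 * u ^ 3 +
          β ^ 2 * u ^ 2 := fun u ↦ by ring
    simp only [he, sum_add_distrib, ← mul_sum, m2 x hx, m3, m4 x hx, m5, m6 x hx, m7]
    rw [hβ]
    field_simp
    ring
  have hroot : ∀ u : ℝ, u ^ 2 - β = 0 → u = r ∨ u = -r := fun u hu ↦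
    sq_eq_sq_iff_eq_or_eq_neg.1 (by linarith)
  have hcR : #({0, r, -r} : Finset ℝ) = 3 :=
    card_eq_three.2 ⟨0, r, -r, hr0.ne, by linarith, by linarith, rfl⟩
  refine hD.antipodal_and_triplyRegular (g := fun u ↦ u * (u ^ 2 - β)) {0, r, -r} (fun u hu ↦ ?_)
    (fun x hx ↦ ?_) (fun x hx ↦ ?_) ?_ (by rw [hcR]; norm_num) (by rw [hcR]) ?_
  · simpa using (mul_eq_zero.1 hu).imp_right (hroot u)
  · simpa using hsum 1 x hx
  · have := hsum (-1) x hx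
    simp only [neg_one_mul, ← sub_eq_add_neg] at this
    rw [this]
    have : 1 - β ≠ 0 := by linarith
    simpa using this
  · simp only [mem_insert, mem_singleton]
    rintro _ (rfl | rfl | rfl) <;> constructor <;> linarith
  · intro hneg h0
    obtain ⟨x, hx⟩ := hD.nonempty
    -- Both factors of `g` have to vanish somewhere, since each has a nonzero weighted sum.
    obtain ⟨w, hw, h1, h2, h3⟩ := hD.exists_inner_ne_zero hx (fun u ↦ u ^ 2) (by
      have he : ∀ u : ℝ, u ^ 2 * (1 - u ^ 2) = u ^ 2 - u ^ 4 := fun u ↦ by ring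
      simp only [he, sum_sub_distrib, m2 x hx, m4 x hx]
      nlinarith)
    obtain ⟨v, hv, h4, h5, h6⟩ := hD.exists_inner_ne_zero hx (fun u ↦ u ^ 2 - β) (by
      have he : ∀ u : ℝ, (u ^ 2 - β) * (1 - u ^ 2) = (1 + β) * u ^ 2 - u ^ 4 - β :=
        fun u ↦ by ring
      simp only [he, sum_sub_distrib, ← mul_sum, m2 x hx, m4 x hx, sum_const, nsmul_eq_mul, hcard]
      have : (1 + β) * ((d + 1) * (d + 2) / 3) - (d + 1) - d * (d + 1) * (d + 2) / 3 * β =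
          -(2 * (d + 1) * (d - 1) * (d + 1) / (3 * (d + 4)) : ℝ) := by
        rw [hβ]; field_simp; ring
      rw [this, neg_ne_zero]
      have : (0 : ℝ) < d - 1 := by linarith
      positivity)
    have h7 := (mul_eq_zero.1 (h0 w hw x hx h1 h2)).resolve_left fun h ↦ h3 (by simp [h])
    have h8 := (mul_eq_zero.1 (h0 v hv x hx h4 h5)).resolve_right h6
    simp only [mem_insert, mem_singleton]
    rcases hroot _ h7 with h3 | h3
    · rintro _ (rfl | rfl | rfl)
      · exact ⟨v, hv, x, hx, h8⟩
      · exact ⟨w, hw, x, hx, h3⟩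
      · exact ⟨-w, hneg w hw, x, hx, by rw [inner_neg_left, h3]⟩
    · rintro _ (rfl | rfl | rfl)
      · exact ⟨v, hv, x, hx, h8⟩
      · exact ⟨-w, hneg w hw, x, hx, by rw [inner_neg_left, h3, neg_neg]⟩
      · exact ⟨w, hw, x, hx, h3⟩

end SphericalDesign


theorem mainTheorem4 (d t : ℕ) (hd : 2 ≤ d) (ht : t = 5 ∨ t = 7)
    (X : Finset (EuclideanSpace ℝ (Fin d))) (hX : SphericalDesign.IsTightDesign t X) :
    (∀ x ∈ X, -x ∈ X) ∧
    (t : ℤ) = 2 * ((SphericalDesign.angleSet X).ncard : ℤ) - 1 ∧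
    SphericalDesign.IsTriplyRegularScheme (SphericalDesign.angleRel X)
      ⟨1, Set.mem_insert 1 (SphericalDesign.angleSet X)⟩ := by
  rcases ht with rfl | rfl
  · exact hX.of_five hd
  · exact hX.of_seven hd
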